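/- Let $X$ be a complex Banach space, $T$ a bounded linear operator on $X$, and $x\in X$. Let $\rho_T(x)$ be the set of all $\lambda\in\mathbb{C}$ for which there are an open neighborhood $U_\lambda$ of $\lambda$ and an analytic function $u:U_\lambda\to X$ with $(zI-T)u(z)=x$ for all $z\in U_\lambda$; let $\sigma_T(x)=\mathbb{C}\setminus\rho_T(x)$ be the local spectrum of $T$ at $x$, and let $$r_T(x)=\sup\{|\lambda|:\lambda\in\sigma_T(x)\}$$ be the local spectral radius of $T$ at $x$ (with $r_T(x)=0$ if $\sigma_T(x)=\emptyset$). Assume that $T$ has the single-valued extension property (SVEP): for every open set $U\subseteq\mathbb{C}$, the only analytic function $u:U\to X$ satisfying $(zI-T)u(z)=0$ for all $z\in U$ is $u\equiv 0$. Let $0\le\alpha<1$ and $C>0$ (with the convention $0^0=1$), and assume that $$\|e^{tT}x\|\le C\,(1+|t|^{\alpha})\qquad\text{for all } t\in\mathbb{R}.$$ Then $$\|Tx\|\le C\left[\,r_T(x)+C(\alpha)\,r_T(x)^{1-\alpha}\right],\qquad\text{where}\quad C(\alpha)=\left(\frac{2}{\pi}\right)^{2-\alpha}\sum_{k\in\mathbb{Z}}\frac{1}{|2k+1|^{2-\alpha}}.$$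 -/

import Mathlib

/-- The local resolvent set of `T` at `x`: the points `w` that have a neighbourhood `U` carrying an
analytic function `u` with `(z - T) u z = x` for all `z ∈ U`. -/
def localResolventSet {X : Type*} [NormedAddCommGroup X] [NormedSpace ℂ X]
    (T : X →L[ℂ] X) (x : X) : Set ℂ :=
  {w | ∃ U : Set ℂ, IsOpen U ∧ w ∈ U ∧
    ∃ u : ℂ → X, AnalyticOnNhd ℂ u U ∧ ∀ z ∈ U, z • u z - T (u z) = x}

/-- The local spectrum of `T` at `x`: the complement of the local resolvent set. -/
def localSpectrum {X : Type*} [NormedAddCommGroup X] [NormedSpace ℂ X]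
    (T : X →L[ℂ] X) (x : X) : Set ℂ :=
  (localResolventSet T x)ᶜ

/-- The local spectral radius of `T` at `x`: the supremum of `|w|` over the local spectrum. The set
is bounded, see `bddAbove_norm_localSpectrum`; it can be empty (for example at `x = 0`), and then
the value is `0`. -/
noncomputable def localSpectralRadius {X : Type*} [NormedAddCommGroup X] [NormedSpace ℂ X]
    (T : X →L[ℂ] X) (x : X) : ℝ :=
  sSup ((fun w : ℂ => ‖w‖) '' localSpectrum T x)

/-- The single-valued extension property: on every open `U ⊆ ℂ` the only analytic `u : U → X` with
`(z - T) u z = 0` for all `z ∈ U` is the zero function. -/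
def HasSVEP {X : Type*} [NormedAddCommGroup X] [NormedSpace ℂ X] (T : X →L[ℂ] X) : Prop :=
  ∀ U : Set ℂ, IsOpen U → ∀ u : ℂ → X, AnalyticOnNhd ℂ u U →
    (∀ z ∈ U, z • u z - T (u z) = 0) → ∀ z ∈ U, u z = 0

/-- The constant `C(α) = (2/π)^(2-α) * ∑_{k ∈ ℤ} 1 / |2k+1|^(2-α)`; the series converges for
`α < 1`, see `summable_growthConst`. -/
noncomputable def growthConst (α : ℝ) : ℝ :=
  (2 / Real.pi) ^ (2 - α) * ∑' k : ℤ, 1 / |2 * (k : ℝ) + 1| ^ (2 - α)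

/-- The local spectrum is contained in the spectrum. -/
theorem localSpectrum_subset_spectrum {X : Type*} [NormedAddCommGroup X] [NormedSpace ℂ X]
    [CompleteSpace X] (T : X →L[ℂ] X) (x : X) : localSpectrum T x ⊆ spectrum ℂ T := by
  intro w hw hwr
  refine hw ⟨resolventSet ℂ T, spectrum.isOpen_resolventSet T, hwr,
    fun z => resolvent T z x, ?_, ?_⟩
  · have hd : DifferentiableOn ℂ (fun z => resolvent T z x) (resolventSet ℂ T) := by
      intro z hz
      have h := (spectrum.hasDerivAt_resolvent_const_left hz).differentiableAt
      exact (h.clm_apply (differentiableAt_const x)).differentiableWithinAt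
    exact hd.analyticOnNhd (spectrum.isOpen_resolventSet T)
  · intro z hz
    have h : (algebraMap ℂ (X →L[ℂ] X) z - T) * resolvent T z = 1 :=
      Ring.mul_inverse_cancel _ hz
    have h2 := congrArg (fun S : X →L[ℂ] X => S x) h
    simpa [Algebra.algebraMap_eq_smul_one] using h2

/-- The moduli of the points of the local spectrum are bounded. -/
theorem bddAbove_norm_localSpectrum {X : Type*} [NormedAddCommGroup X] [NormedSpace ℂ X]
    [CompleteSpace X] (T : X →L[ℂ] X) (x : X) :
    BddAbove ((fun w : ℂ => ‖w‖) '' localSpectrum T x) := by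
  refine ⟨‖T‖ * ‖(1 : X →L[ℂ] X)‖, ?_⟩
  rintro _ ⟨w, hw, rfl⟩
  exact spectrum.norm_le_norm_mul_of_mem (localSpectrum_subset_spectrum T x hw)

/-- The series in `growthConst` converges for `α < 1`. -/
theorem summable_growthConst {α : ℝ} (hα : α < 1) :
    Summable (fun k : ℤ => 1 / |2 * (k : ℝ) + 1| ^ (2 - α)) := by
  have h : Summable (fun n : ℤ => |(n : ℝ)| ^ (-(2 - α))) :=
    Real.summable_abs_int_rpow (by linarith)
  have hi : Function.Injective (fun k : ℤ => 2 * k + 1) := fun a b hab => by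
    simp only at hab; omega
  refine (h.comp_injective hi).congr fun k => ?_
  rw [Function.comp_apply, Real.rpow_neg (abs_nonneg _), one_div]
  push_cast
  rfl

/-! Choose a functional `φ` of norm at most 1 with `φ (T x) = ‖T x‖` and put F(z) = φ(e^{zT} x), an
entire function with |F'(0)| = ‖Tx‖. The claim becomes a Bernstein inequality for F.

The local spectral radius r controls the exponential type. By SVEP the local resolvents form one
analytic function u on |z| > r, and w⁻¹u(w⁻¹) continues the Neumann series ∑ wⁿTⁿx to |w| < 1/r.
Cauchy estimates give ‖Tⁿx‖ ≤ M sⁿ for each s > r (`HasSVEP.norm_pow_apply_le`), so F has type at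
most s.

For the Bernstein inequality (`norm_deriv_zero_le_of_exp_type`), rescale the odd part of F to a
function f of type π and integrate f(z)/(z² cos πz) over |z| = N. Phragmén–Lindelöf makes the
integrals O(N^(α-1)), so f'(0) is a limit of residue sums over the half-integers. Inserting the
growth bound at these nodes, the constant 1 contributes s and |t|^α contributes C(α) s^(1-α).
Finally s decreases to r. -/

open Complex Metric Set Filter Topology

/-! ### Residues at simple zeros of the denominator -/

/-- The residue formula on a circle for a quotient `f / D` of entire functions, where `D` has only
simple zeros in the closed disc. -/
theorem circleIntegral_div_eq_sum {R : ℝ} (hR : 0 < R) (S : Finset ℂ) {f D : ℂ → ℂ}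
    (hf : Differentiable ℂ f) (hD : Differentiable ℂ D)
    (hS : ∀ a ∈ S, a ∈ ball (0 : ℂ) R ∧ D a = 0 ∧ deriv D a ≠ 0)
    (hne : ∀ z ∈ closedBall (0 : ℂ) R, z ∉ S → D z ≠ 0) :
    (∮ z in C(0, R), f z / D z) = 2 * Real.pi * I * ∑ a ∈ S, f a / deriv D a := by
  have hds : ∀ {g : ℂ → ℂ} (a : ℂ), Differentiable ℂ g → Differentiable ℂ (dslope g a) := by
    intro g a hg
    rw [← differentiableOn_univ] at hg ⊢
    exact (Complex.differentiableOn_dslope univ_mem).2 hg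
  induction S using Finset.induction_on generalizing f D with
  | empty =>
    simp only [Finset.notMem_empty, not_false_eq_true, forall_true_left] at hne
    simp only [Finset.sum_empty, mul_zero]
    refine circleIntegral_eq_zero_of_differentiable_on_off_countable hR.le countable_empty ?_ ?_
    · exact hf.continuous.continuousOn.div hD.continuous.continuousOn hne
    · exact fun z hz => (hf z).div (hD z) (hne z (ball_subset_closedBall hz.1))
  | insert a S ha ih =>
    obtain ⟨haR, hDa, hD'a⟩ := hS a (Finset.mem_insert_self _ _)
    -- Peel off one pole: D = (z-a)E and f = cE + (z-a)g, so f/D = c/(z-a) + g/E. At the other zeros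
    -- g/E has the same residues as f/D.
    set E := dslope D a with hE
    have hEd : Differentiable ℂ E := hds a hD
    have hDE : ∀ z, D z = (z - a) * E z := fun z => by
      have := sub_smul_dslope D a z
      rw [hDa, sub_zero, smul_eq_mul] at this
      exact this.symm
    have hEa : E a = deriv D a := dslope_same _ _
    set c := f a / deriv D a with hc
    set g := dslope (fun z => f z - c * E z) a with hg
    have hgd : Differentiable ℂ g := hds a (hf.sub (hEd.const_mul c))
    have hfg : ∀ z, f z = c * E z + (z - a) * g z := fun z => by
      have := sub_smul_dslope (fun z => f z - c * E z) a z
      rw [hEa, hc, div_mul_cancel₀ _ hD'a, sub_self, sub_zero, smul_eq_mul, ← hc] at this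
      rw [hg, this]; ring
    have hne' : ∀ b ∈ S, b - a ≠ 0 := fun b hb h => ha (by rwa [← sub_eq_zero.1 h])
    have hDd : ∀ b, deriv D b = E b + (b - a) * deriv E b := fun b => by
      have h : HasDerivAt (fun z => (z - a) * E z) (1 * E b + (b - a) * deriv E b) b :=
        ((hasDerivAt_id b).sub_const a).mul (hEd b).hasDerivAt
      rw [show D = fun z => (z - a) * E z from funext hDE, h.deriv, one_mul]
    have hEb : ∀ b ∈ S, E b = 0 := fun b hb => by
      have := (hS b (Finset.mem_insert_of_mem hb)).2.1
      rw [hDE] at this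
      exact (mul_eq_zero.1 this).resolve_left (hne' b hb)
    have hEne : ∀ z ∈ closedBall (0 : ℂ) R, z ∉ S → E z ≠ 0 := by
      intro z hz hzS
      by_cases hza : z = a
      · rw [hza, hEa]; exact hD'a
      · intro h0
        exact hne z hz (by simp [hza, hzS]) (by rw [hDE, h0, mul_zero])
    have hsph : ∀ z ∈ sphere (0 : ℂ) R, z ∉ insert a S := fun z hz hzS => by
      have h1 := (hS z hzS).1
      rw [mem_ball] at h1; rw [mem_sphere] at hz; linarith
    have key := ih hgd hEd (fun b hb => ⟨(hS b (Finset.mem_insert_of_mem hb)).1, hEb b hb, by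
        have h := (hS b (Finset.mem_insert_of_mem hb)).2.2
        rw [hDd, hEb b hb, zero_add] at h
        exact right_ne_zero_of_mul h⟩) hEne
    have hEq : EqOn (fun z => f z / D z) (fun z => c * (z - a)⁻¹ + g z / E z) (sphere 0 R) := by
      intro z hz
      have hzS := hsph z hz
      rw [Finset.mem_insert, not_or] at hzS
      have h1 : z - a ≠ 0 := sub_ne_zero.2 hzS.1
      have h2 := hEne z (sphere_subset_closedBall hz) hzS.2
      change f z / D z = _
      rw [hfg, hDE]
      field_simp
    rw [circleIntegral.integral_congr hR.le hEq, circleIntegral.integral_add, key,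
      circleIntegral.integral_const_mul, circleIntegral.integral_sub_inv_of_mem_ball haR,
      Finset.sum_insert ha]
    · rw [mul_add, mul_comm c]
      congr 2
      refine Finset.sum_congr rfl fun b hb => ?_
      rw [hDd, hfg b, hEb b hb, zero_add, mul_zero, zero_add,
        mul_div_mul_left _ _ (hne' b hb)]
    · refine ContinuousOn.circleIntegrable hR.le (continuousOn_const.mul ?_)
      refine (continuousOn_id.sub continuousOn_const).inv₀ fun z hz => ?_
      have hzS := hsph z hz
      rw [Finset.mem_insert, not_or] at hzS
      exact sub_ne_zero.2 hzS.1
    · refine ContinuousOn.circleIntegrable hR.le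
        (hgd.continuous.continuousOn.div hEd.continuous.continuousOn fun z hz => ?_)
      have hzS := hsph z hz
      rw [Finset.mem_insert, not_or] at hzS
      exact hEne z (sphere_subset_closedBall hz) hzS.2

/-! ### Lower bound for cos(πz) away from its zeros -/

theorem norm_cos_sq (z : ℂ) : ‖Complex.cos z‖ ^ 2 = Real.cos z.re ^ 2 + Real.sinh z.im ^ 2 := by
  rw [← Complex.normSq_eq_norm_sq, Complex.normSq_apply, Complex.cos_eq]
  simp only [← ofReal_cos, ← ofReal_cosh, ← ofReal_sin, ← ofReal_sinh, ← ofReal_mul, sub_re,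
    sub_im, ofReal_re, ofReal_im, mul_re, mul_im, I_re, I_im]
  have h1 := Real.cos_sq_add_sin_sq z.re
  have h2 := Real.cosh_sq z.im
  ring_nf
  rw [h2, show Real.sin z.re ^ 2 = 1 - Real.cos z.re ^ 2 by linarith]
  ring

/-- On circles of positive integral radius, `cos (π z)` is bounded below by a multiple of
`exp (π |Im z|)`. -/
theorem exp_le_norm_cos_pi_mul {N : ℕ} (hN : 0 < N) {z : ℂ} (hz : ‖z‖ = N) :
    Real.exp (Real.pi * |z.im|) / 20 ≤ ‖Complex.cos (Real.pi * z)‖ := by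
  have hπ := Real.pi_pos
  have hsq := norm_cos_sq (Real.pi * z)
  rw [re_ofReal_mul, im_ofReal_mul] at hsq
  -- For large |Im z| the sinh term suffices. Otherwise |Re z| is within 1/4 of the integer N, far
  -- from the half-integer zeros. The factor 20 has slack.
  rcases le_or_gt (1 / 2) |z.im| with hy | hy
  · have h1 : |Real.sinh (Real.pi * z.im)| ≤ ‖Complex.cos (Real.pi * z)‖ := by
      refine abs_le_of_sq_le_sq' ?_ (norm_nonneg _) |> abs_le.2
      rw [hsq]; nlinarith [sq_nonneg (Real.cos (Real.pi * z.re))]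
    rw [Real.abs_sinh, abs_mul, abs_of_pos hπ, Real.sinh_eq] at h1
    have h2 : Real.exp (-(Real.pi * |z.im|)) ≤ 1 := by
      rw [Real.exp_le_one_iff]
      have := mul_nonneg hπ.le (abs_nonneg z.im); linarith
    have h3 : 2 ≤ Real.exp (Real.pi * |z.im|) := by
      have h4 := Real.add_one_le_exp (Real.pi * |z.im|)
      nlinarith [Real.pi_gt_three]
    linarith
  · have hx2 : z.re ^ 2 + z.im ^ 2 = (N : ℝ) ^ 2 := by
      rw [← hz, ← Complex.normSq_eq_norm_sq, Complex.normSq_apply]; ring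
    have hy2 : z.im ^ 2 ≤ 1 / 4 := by
      rw [← sq_abs]; nlinarith [abs_nonneg z.im]
    have hN1 : (1 : ℝ) ≤ N := by exact_mod_cast hN
    have hxN : |z.re| ≤ N := abs_le_of_sq_le_sq (by nlinarith [sq_nonneg z.im]) (by linarith)
    have hd : N - |z.re| ≤ 1 / 4 := by
      have : |z.re| ^ 2 = N ^ 2 - z.im ^ 2 := by rw [sq_abs]; linarith
      nlinarith [abs_nonneg z.re]
    have hcos : Real.cos (Real.pi * z.re) ^ 2 = Real.cos (Real.pi * (N - |z.re|)) ^ 2 := by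
      rw [← Real.cos_abs, abs_mul, abs_of_pos hπ, mul_sub, mul_comm Real.pi (N : ℝ),
        Real.cos_nat_mul_pi_sub, mul_pow, ← pow_mul, mul_comm N 2, pow_mul]
      simp
    have hc : Real.cos (Real.pi / 4) ≤ Real.cos (Real.pi * (N - |z.re|)) := by
      apply Real.cos_le_cos_of_nonneg_of_le_pi
      · exact mul_nonneg hπ.le (by linarith)
      · linarith
      · nlinarith
    rw [Real.cos_pi_div_four] at hc
    have h2 : (1.4 : ℝ) ≤ √2 := Real.le_sqrt_of_sq_le (by norm_num)
    have h3 : (0.7 : ℝ) ≤ ‖Complex.cos (Real.pi * z)‖ := by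
      refine le_of_sq_le_sq ?_ (norm_nonneg _)
      rw [hsq, hcos]
      nlinarith [sq_nonneg (Real.sinh (Real.pi * z.im))]
    have h4 : Real.exp (Real.pi * |z.im|) ≤ 8 := by
      have h5 : Real.pi * |z.im| ≤ 1.6 := by nlinarith [Real.pi_lt_d2, abs_nonneg z.im]
      have h6 : Real.exp 1.6 ≤ 8 := by
        have h7 := Real.exp_one_lt_d9
        rw [show (1.6 : ℝ) = 0.8 + 0.8 by norm_num, Real.exp_add]
        have h8 : Real.exp 0.8 ≤ Real.exp 1 := Real.exp_le_exp.2 (by norm_num)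
        nlinarith [Real.exp_pos 0.8, Real.exp_pos 1]
      exact (Real.exp_le_exp.2 h5).trans h6
    linarith

/-! ### Phragmén–Lindelöf bounds -/

/-- The quotient G = F(z)e^{isz}/(z+i)^α is bounded by 2A on the real axis and by M on the positive
imaginary axis, and has order at most 1, so Phragmén–Lindelöf applies in both quadrants. The shift
by i avoids the branch cut and keeps |z+i| ≥ 1. -/
theorem phragmenLindelof_upper {F : ℂ → ℂ} (hF : Differentiable ℂ F) {M s A α : ℝ} (hα : 0 ≤ α)
    (hA : 0 ≤ A) (hs : 0 ≤ s) (hexp : ∀ z, ‖F z‖ ≤ M * Real.exp (s * ‖z‖))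
    (hreal : ∀ t : ℝ, ‖F t‖ ≤ A * (1 + |t| ^ α)) {z : ℂ} (hz : 0 ≤ z.im) :
    ‖F z‖ ≤ max (2 * A) M * (1 + ‖z‖) ^ α * Real.exp (s * z.im) := by
  have hM : 0 ≤ M := by simpa using (norm_nonneg _).trans (hexp 0)
  set G : ℂ → ℂ := fun z => F z * Complex.exp (I * s * z) / (z + I) ^ (α : ℂ) with hG
  have hden : ∀ z : ℂ, 0 ≤ z.im → 1 ≤ ‖z + I‖ := fun z hz => by
    have := (le_abs_self _).trans (abs_im_le_norm (z + I))
    simp only [add_im, I_im] at this; linarith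
  have hrp : ∀ z : ℂ, 0 ≤ z.im → 1 ≤ ‖z + I‖ ^ α := fun z hz =>
    Real.one_le_rpow (hden z hz) hα
  have hGn : ∀ z, ‖G z‖ = ‖F z‖ * Real.exp (-(s * z.im)) / ‖z + I‖ ^ α := fun z => by
    simp only [hG]
    rw [norm_div, norm_mul, norm_cpow_real, Complex.norm_exp]
    congr 3
    simp
  have hGle : ∀ z : ℂ, 0 ≤ z.im → ‖G z‖ ≤ M * Real.exp (s * ‖z‖) * Real.exp (-(s * z.im)) := by
    intro z hz
    rw [hGn]
    refine (div_le_self (by positivity) (hrp z hz)).trans ?_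
    gcongr
    exact hexp z
  have hd : ∀ z : ℂ, 0 ≤ z.im → DifferentiableAt ℂ G z := by
    intro z hz
    have hsl : z + I ∈ slitPlane := by
      refine mem_slitPlane_iff.2 (Or.inr (ne_of_gt ?_))
      simp only [add_im, I_im]; positivity
    refine ((hF z).mul (by fun_prop)).div
      ((differentiableAt_id.add_const I).cpow (differentiableAt_const _) hsl) ?_
    exact fun h => slitPlane_ne_zero hsl ((cpow_eq_zero_iff _ _).1 h).1
  have hB : ∀ t : Set ℝ, ∃ c < (2 : ℝ), ∃ B,
      G =O[Bornology.cobounded ℂ ⊓ 𝓟 (t ×ℂ Ioi 0)] fun z => Real.exp (B * ‖z‖ ^ c) := by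
    intro t
    refine ⟨1, by norm_num, s, Asymptotics.IsBigO.of_bound M ?_⟩
    refine eventually_inf_principal.2 (Eventually.of_forall fun z hz => ?_)
    have hz0 : 0 ≤ z.im := (mem_reProdIm.1 hz).2.le
    refine (hGle z hz0).trans ?_
    rw [Real.rpow_one, Real.norm_of_nonneg (Real.exp_pos _).le]
    refine mul_le_of_le_one_right (by positivity) ?_
    rw [Real.exp_le_one_iff]
    have := mul_nonneg hs hz0; linarith
  have hre : ∀ x : ℝ, ‖G x‖ ≤ max (2 * A) M := by
    intro x
    refine le_trans ?_ (le_max_left _ _)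
    rw [hGn, div_le_iff₀ (by have := hrp x (by simp); linarith)]
    simp only [ofReal_im, mul_zero, neg_zero, Real.exp_zero, mul_one]
    refine (hreal x).trans ?_
    have h1 := hrp x (by simp)
    have h2 : |x| ^ α ≤ ‖(x : ℂ) + I‖ ^ α := by
      refine Real.rpow_le_rpow (abs_nonneg x) ?_ hα
      simpa using abs_re_le_norm ((x : ℂ) + I)
    nlinarith
  have him : ∀ x : ℝ, 0 ≤ x → ‖G (x * I)‖ ≤ max (2 * A) M := by
    intro x hx
    refine le_trans ?_ (le_max_right _ _)
    refine (hGle _ (by simpa using hx)).trans ?_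
    rw [mul_assoc, ← Real.exp_add]
    simp [abs_of_nonneg hx]
  have hdc : ∀ t : Set ℝ, DiffContOnCl ℂ G (t ×ℂ Ioi 0) := by
    intro t
    refine DifferentiableOn.diffContOnCl fun z hz => (hd z ?_).differentiableWithinAt
    rw [closure_reProdIm, closure_Ioi] at hz
    exact hz.2
  have hfin : ‖G z‖ ≤ max (2 * A) M := by
    rcases le_total 0 z.re with h | h
    · exact PhragmenLindelof.quadrant_I (hdc _) (hB _) (fun x _ => hre x) him h hz
    · exact PhragmenLindelof.quadrant_II (hdc _) (hB _) (fun x _ => hre x) him h hz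
  have h1 : ‖z + I‖ ^ α ≤ (1 + ‖z‖) ^ α := by
    refine Real.rpow_le_rpow (norm_nonneg _) ?_ hα
    refine (norm_add_le _ _).trans ?_
    rw [norm_I, add_comm]
  rw [hGn, div_le_iff₀ (by have := hrp z hz; linarith)] at hfin
  calc ‖F z‖ = ‖F z‖ * Real.exp (-(s * z.im)) * Real.exp (s * z.im) := by
        rw [mul_assoc, ← Real.exp_add]; simp
    _ ≤ max (2 * A) M * ‖z + I‖ ^ α * Real.exp (s * z.im) := by gcongr
    _ ≤ _ := by gcongr

/-- An entire function of exponential type `s` with growth `O(1 + |t| ^ α)` on the real line is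
`O((1 + ‖z‖) ^ α * exp (s |Im z|))`. -/
theorem phragmenLindelof_exp_type {F : ℂ → ℂ} (hF : Differentiable ℂ F) {M s A α : ℝ} (hα : 0 ≤ α)
    (hA : 0 ≤ A) (hs : 0 ≤ s) (hexp : ∀ z, ‖F z‖ ≤ M * Real.exp (s * ‖z‖))
    (hreal : ∀ t : ℝ, ‖F t‖ ≤ A * (1 + |t| ^ α)) (z : ℂ) :
    ‖F z‖ ≤ max (2 * A) M * (1 + ‖z‖) ^ α * Real.exp (s * |z.im|) := by
  rcases le_total 0 z.im with h | h
  · rw [abs_of_nonneg h]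
    exact phragmenLindelof_upper hF hα hA hs hexp hreal h
  · have := phragmenLindelof_upper (F := fun z => F (-z)) (hF.comp differentiable_neg) hα hA hs
      (fun z => by simpa using hexp (-z)) (fun t => by simpa using hreal (-t)) (z := -z)
      (by simpa using h)
    rw [abs_of_nonpos h]
    simpa using this

/-! ### Interpolation at the half-integers -/

/-- Consequence of the Riesz interpolation formula for entire functions of exponential type `π`
vanishing at `0`. -/
theorem norm_deriv_zero_le_tsum {f : ℂ → ℂ} (hf : Differentiable ℂ f) (hf0 : f 0 = 0) {K α : ℝ}
    (hK : 0 ≤ K) (hα : α < 1)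
    (hbd : ∀ z, ‖f z‖ ≤ K * (1 + ‖z‖) ^ α * Real.exp (Real.pi * |z.im|)) {b : ℤ → ℝ}
    (hb : Summable b) (hfb : ∀ k : ℤ, ‖f (k + 1 / 2)‖ / (Real.pi * (k + 1 / 2) ^ 2) ≤ b k) :
    ‖deriv f 0‖ ≤ ∑' k, b k := by
  have hπ := Real.pi_pos
  have hπ0 : (Real.pi : ℂ) ≠ 0 := ofReal_ne_zero.2 hπ.ne'
  have hb0 : ∀ k, 0 ≤ b k := fun k => le_trans (by positivity) (hfb k)
  have hgd : Differentiable ℂ (dslope f 0) := by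
    rw [← differentiableOn_univ]
    exact (Complex.differentiableOn_dslope univ_mem).2 hf.differentiableOn
  have hg : ∀ z, z ≠ 0 → dslope f 0 z = f z / z := fun z hz => by
    rw [dslope_of_ne _ hz, slope_def_field, hf0, sub_zero, sub_zero]
  -- Since f(0) = 0, f(z)/z is entire; dividing it by D leaves simple poles, with residue f'(0) at
  -- 0.
  set D : ℂ → ℂ := fun z => z * Complex.cos (Real.pi * z) with hDdef
  have hDd : Differentiable ℂ D := by fun_prop
  have hDderiv : ∀ z, deriv D z
      = Complex.cos (Real.pi * z) - z * (Complex.sin (Real.pi * z) * Real.pi) := fun z => by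
    have h : HasDerivAt D (1 * Complex.cos (Real.pi * z)
        + z * (-Complex.sin (Real.pi * z) * (Real.pi * 1))) z :=
      (hasDerivAt_id z).mul (((hasDerivAt_id z).const_mul (Real.pi : ℂ)).ccos)
    rw [h.deriv]; ring
  have hhalf : ∀ k : ℤ, Real.pi * ((k : ℂ) + 1 / 2) = (2 * k + 1) * Real.pi / 2 := fun k => by ring
  have hcosz : ∀ k : ℤ, Complex.cos (Real.pi * ((k : ℂ) + 1 / 2)) = 0 := fun k => by
    rw [Complex.cos_eq_zero_iff]; exact ⟨k, hhalf k⟩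
  have hknorm : ∀ k : ℤ, ‖(k : ℂ) + 1 / 2‖ = |(k : ℝ) + 1 / 2| := fun k => by
    rw [← Real.norm_eq_abs, ← Complex.norm_real]; push_cast; rfl
  have hkne : ∀ k : ℤ, (k : ℝ) + 1 / 2 ≠ 0 := fun k h => by
    have h2 : (2 * k + 1 : ℝ) = 0 := by linarith
    have h3 : (2 * k + 1 : ℤ) = 0 := by exact_mod_cast h2
    omega
  have hkneC : ∀ k : ℤ, (k : ℂ) + 1 / 2 ≠ 0 := fun k => by
    rw [← norm_ne_zero_iff, hknorm]; exact abs_ne_zero.2 (hkne k)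
  have hDk : ∀ k : ℤ, ‖deriv D (k + 1 / 2)‖ = |(k : ℝ) + 1 / 2| * Real.pi := fun k => by
    have hs : ‖Complex.sin (Real.pi * ((k : ℂ) + 1 / 2))‖ = 1 := by
      have h := Complex.sin_sq_add_cos_sq (Real.pi * ((k : ℂ) + 1 / 2))
      rw [hcosz, zero_pow two_ne_zero, add_zero] at h
      have h2 := congrArg norm h
      rw [norm_pow, norm_one] at h2
      exact (pow_eq_one_iff_of_nonneg (norm_nonneg _) two_ne_zero).1 h2
    rw [hDderiv, hcosz, zero_sub, norm_neg, norm_mul, norm_mul, hs, hknorm, one_mul,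
      Complex.norm_real, Real.norm_of_nonneg hπ.le]
  have hD0 : deriv D 0 = 1 := by rw [hDderiv]; simp
  have hmain : ∀ N : ℕ, 0 < N →
      ‖deriv f 0‖ ≤ 20 * K * ((1 + (N : ℝ)) ^ α / N) + ∑' k, b k := by
    intro N hN
    have hNR : (0 : ℝ) < N := by exact_mod_cast hN
    -- |k + 1/2| < N holds exactly for -N ≤ k < N.
    set S1 : Finset ℂ := (Finset.Ico (-(N : ℤ)) N).image fun k : ℤ => (k : ℂ) + 1 / 2 with hS1
    have h0S : (0 : ℂ) ∉ S1 := by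
      rw [hS1, Finset.mem_image]
      rintro ⟨k, -, hk⟩
      exact hkneC k hk
    have hres := circleIntegral_div_eq_sum hNR (insert 0 S1) hgd hDd (by
      intro a ha
      rw [Finset.mem_insert] at ha
      rcases ha with rfl | ha
      · exact ⟨by simpa using hN, by simp [hDdef], by rw [hD0]; exact one_ne_zero⟩
      · rw [hS1, Finset.mem_image] at ha
        obtain ⟨k, hk, rfl⟩ := ha
        refine ⟨?_, by simp only [hDdef]; rw [hcosz, mul_zero], ?_⟩
        · rw [mem_ball_zero_iff, hknorm, abs_lt]
          rw [Finset.mem_Ico] at hk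
          have h1 : (-(N : ℝ)) ≤ k := by exact_mod_cast hk.1
          have h2 : (k : ℝ) + 1 ≤ N := by exact_mod_cast hk.2
          constructor <;> linarith
        · rw [← norm_ne_zero_iff, hDk]
          exact mul_ne_zero (abs_ne_zero.2 (hkne k)) hπ.ne') (by
      intro z hz hzS
      rw [Finset.mem_insert, not_or] at hzS
      refine mul_ne_zero hzS.1 fun hc => hzS.2 ?_
      rw [Complex.cos_eq_zero_iff] at hc
      obtain ⟨k, hk⟩ := hc
      have hzk : z = k + 1 / 2 := by
        rw [← hhalf] at hk; exact mul_left_cancel₀ hπ0 hk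
      rw [hS1, Finset.mem_image]
      refine ⟨k, ?_, hzk.symm⟩
      rw [mem_closedBall_zero_iff, hzk, hknorm, abs_le] at hz
      rw [Finset.mem_Ico]
      have h1 : (-(N : ℤ) : ℝ) < k + 1 := by push_cast; linarith
      have h2 : (k : ℝ) < (N : ℤ) := by push_cast; linarith
      have h1' : -(N : ℤ) < k + 1 := by exact_mod_cast h1
      have h2' : k < (N : ℤ) := by exact_mod_cast h2
      omega)
    -- The factors exp(π|Im z|) of f and of cos cancel.
    have hint : ‖∮ z in C(0, N), dslope f 0 z / D z‖
        ≤ 2 * Real.pi * N * (20 * K * ((1 + (N : ℝ)) ^ α / N) / N) := by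
      refine circleIntegral.norm_integral_le_of_norm_le_const hNR.le fun z hz => ?_
      rw [mem_sphere_zero_iff_norm] at hz
      have hz0 : z ≠ 0 := by rw [← norm_ne_zero_iff, hz]; exact hNR.ne'
      have hcos := exp_le_norm_cos_pi_mul hN hz
      have hE := Real.exp_pos (Real.pi * |z.im|)
      rw [hg z hz0, norm_div, norm_div, norm_mul, hz]
      have h1 := hbd z
      rw [hz] at h1
      calc ‖f z‖ / N / (N * ‖Complex.cos (Real.pi * z)‖)
          ≤ K * (1 + (N : ℝ)) ^ α * Real.exp (Real.pi * |z.im|) / N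
            / (N * (Real.exp (Real.pi * |z.im|) / 20)) := by gcongr
        _ = _ := by field_simp
    have hsplit : deriv f 0 = (2 * Real.pi * I)⁻¹ * (∮ z in C(0, N), dslope f 0 z / D z)
        - ∑ a ∈ S1, dslope f 0 a / deriv D a := by
      rw [hres, Finset.sum_insert h0S, dslope_same, hD0, div_one,
        inv_mul_cancel_left₀ two_pi_I_ne_zero]
      ring
    have hsum : ‖∑ a ∈ S1, dslope f 0 a / deriv D a‖ ≤ ∑' k, b k := by
      rw [hS1, Finset.sum_image fun a _ c _ h => by simpa using h]
      refine (norm_sum_le_of_le _ fun k _ => ?_).trans (hb.sum_le_tsum _ fun k _ => hb0 k)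
      refine le_trans (le_of_eq ?_) (hfb k)
      rw [norm_div, hDk, hg _ (hkneC k), norm_div, hknorm, div_div, ← sq_abs ((k : ℝ) + 1 / 2)]
      ring
    rw [hsplit]
    refine (norm_sub_le _ _).trans (add_le_add ?_ hsum)
    rw [norm_mul, norm_inv]
    have h2 : ‖(2 * Real.pi * I : ℂ)‖ = 2 * Real.pi := by
      simp [abs_of_pos hπ]
    rw [h2, inv_mul_le_iff₀ (by positivity)]
    refine hint.trans (le_of_eq ?_)
    field_simp
  have hlim : Tendsto (fun N : ℕ => 20 * K * ((1 + (N : ℝ)) ^ α / N) + ∑' k, b k) atTop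
      (𝓝 (20 * K * 0 + ∑' k, b k)) := by
    refine ((Tendsto.const_mul _ ?_).add tendsto_const_nhds)
    have h1 : Tendsto (fun N : ℕ => 2 * (1 + (N : ℝ)) ^ (-(1 - α))) atTop (𝓝 (2 * 0)) :=
      ((tendsto_rpow_neg_atTop (by linarith)).comp
        (tendsto_atTop_add_const_left _ 1 tendsto_natCast_atTop_atTop)).const_mul 2
    rw [mul_zero] at h1
    refine squeeze_zero' (Eventually.of_forall fun N => by positivity) ?_ h1
    filter_upwards [eventually_gt_atTop 0] with N hN
    have hN1 : (1 : ℝ) ≤ N := by exact_mod_cast hN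
    rw [div_le_iff₀ (by linarith), show -(1 - α) = α - 1 by ring,
      Real.rpow_sub_one (by positivity)]
    have : 0 < (1 + (N : ℝ)) ^ α := by positivity
    rw [mul_div_assoc', div_mul_eq_mul_div, le_div_iff₀ (by positivity)]
    nlinarith
  rw [mul_zero, zero_add] at hlim
  exact ge_of_tendsto hlim ((eventually_gt_atTop 0).mono hmain)

/-! ### Local resolvent and growth of Tⁿx -/

section LocalSpectrum

variable {X : Type*} [NormedAddCommGroup X] [NormedSpace ℂ X]

/-- Under the SVEP the local resolvents of `T` at `x` glue to one analytic function. -/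
theorem HasSVEP.exists_analytic_resolvent {T : X →L[ℂ] X} (hT : HasSVEP T) (x : X) :
    ∃ u : ℂ → X, AnalyticOnNhd ℂ u (localResolventSet T x) ∧
      ∀ z ∈ localResolventSet T x, z • u z - T (u z) = x := by
  classical
  choose! U hUo hmem v hv hvx using fun (w : ℂ) (hw : w ∈ localResolventSet T x) => hw
  -- Diagonal choice: by SVEP on `U w ∩ U z`, it agrees with the single function `v w` near `w`.
  refine ⟨fun w => v w w, fun w hw => ?_, fun w hw => hvx w hw w (hmem w hw)⟩
  refine (hv w hw w (hmem w hw)).congr ?_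
  filter_upwards [(hUo w hw).mem_nhds (hmem w hw)] with z hz
  have hzr : z ∈ localResolventSet T x := ⟨U w, hUo w hw, hz, v w, hv w hw, hvx w hw⟩
  have h := hT (U w ∩ U z) ((hUo w hw).inter (hUo z hzr)) (v w - v z)
    (((hv w hw).mono inter_subset_left).sub ((hv z hzr).mono inter_subset_right))
    (fun y hy => by
      have h1 := hvx w hw y hy.1
      have h2 := hvx z hzr y hy.2
      rw [Pi.sub_apply, smul_sub, map_sub, sub_sub_sub_comm, h1, h2, sub_self])
    z ⟨hz, hmem z hzr⟩
  exact sub_eq_zero.1 h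

theorem localSpectralRadius_nonneg (T : X →L[ℂ] X) (x : X) : 0 ≤ localSpectralRadius T x :=
  Real.sSup_nonneg (by rintro _ ⟨w, -, rfl⟩; exact norm_nonneg w)

variable [CompleteSpace X]

theorem mem_localResolventSet_of_localSpectralRadius_lt {T : X →L[ℂ] X} {x : X} {w : ℂ}
    (hw : localSpectralRadius T x < ‖w‖) : w ∈ localResolventSet T x := by
  by_contra h
  exact hw.not_ge (le_csSup (bddAbove_norm_localSpectrum T x) ⟨w, h, rfl⟩)

/-- Under the SVEP, `‖T ^ n x‖` grows at most like `s ^ n` for `s` beyond the local spectral radius. -/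
theorem HasSVEP.norm_pow_apply_le {T : X →L[ℂ] X} (hT : HasSVEP T) (x : X) {s : ℝ}
    (hs : localSpectralRadius T x < s) : ∃ M : ℝ, ∀ n : ℕ, ‖(T ^ n) x‖ ≤ M * s ^ n := by
  classical
  have hr0 := localSpectralRadius_nonneg T x
  obtain ⟨q, hrq, hqs⟩ := exists_between hs
  have hq0 : 0 < q := hr0.trans_lt hrq
  have hs0 : 0 < s := hq0.trans hqs
  obtain ⟨u, hu, hux⟩ := hT.exists_analytic_resolvent x
  set p : FormalMultilinearSeries ℂ ℂ X :=
    fun n => ContinuousMultilinearMap.mkPiRing ℂ (Fin n) ((T ^ n) x) with hp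
  set g₀ : ℂ → X := fun w => Ring.inverse (1 - w • T) x with hg₀
  have hp0 : HasFPowerSeriesAt g₀ p 0 := by
    have h := (spectrum.hasFPowerSeriesOnBall_inverse_one_sub_smul ℂ T).hasFPowerSeriesAt
    obtain ⟨r, hr⟩ := h
    convert! ((ContinuousLinearMap.apply ℂ X x).comp_hasFPowerSeriesOnBall
      hr).hasFPowerSeriesAt using 1
  have hunit : ∀ᶠ w : ℂ in 𝓝 0, IsUnit (1 - w • T) := by
    have hc : ContinuousAt (fun w : ℂ => 1 - w • T) 0 := by fun_prop
    exact hc.eventually (Units.isOpen.mem_nhds (by simp))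
  -- The local resolvent in the variable w = 1/z solves (1 - wT)g(w) = x; near 0 invertibility of 1
  -- - wT identifies it with the Neumann series.
  set g : ℂ → X := fun w => if w = 0 then x else w⁻¹ • u w⁻¹ with hg
  have hinv : ∀ w : ℂ, w ≠ 0 → w ∈ ball (0 : ℂ) q⁻¹ → w⁻¹ ∈ localResolventSet T x := by
    intro w hw hwq
    refine mem_localResolventSet_of_localSpectralRadius_lt (hrq.trans ?_)
    rw [mem_ball_zero_iff] at hwq
    rw [norm_inv]
    exact (lt_inv_comm₀ (norm_pos_iff.2 hw) hq0).1 hwq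
  have hgx : ∀ w ∈ ball (0 : ℂ) q⁻¹, (1 - w • T) (g w) = x := by
    intro w hw
    by_cases h0 : w = 0
    · simp [hg, h0]
    · have h := hux _ (hinv w h0 hw)
      simp only [hg, if_neg h0, sub_apply, one_apply_eq_self, smul_apply, map_smul]
      rwa [smul_sub, inv_smul_smul₀ h0]
  have hgg : g₀ =ᶠ[𝓝 0] g := by
    filter_upwards [hunit, ball_mem_nhds (0 : ℂ) (inv_pos.2 hq0)] with w hw hwq
    have h := congrArg (fun S : X →L[ℂ] X => S (g w)) (Ring.inverse_mul_cancel _ hw)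
    simp only [mul_apply_eq_comp, hgx w hwq, one_apply_eq_self] at h
    exact h
  have hgp : HasFPowerSeriesAt g p 0 := hp0.congr hgg
  have hgd : DifferentiableOn ℂ g (ball 0 q⁻¹) := by
    intro w hw
    by_cases h0 : w = 0
    · rw [h0]; exact hgp.analyticAt.differentiableAt.differentiableWithinAt
    · have h1 : DifferentiableAt ℂ (fun w : ℂ => w⁻¹ • u w⁻¹) w :=
        (differentiableAt_inv h0).smul
          (((hu _ (hinv w h0 hw)).differentiableAt).comp w (differentiableAt_inv h0))
      refine (h1.congr_of_eventuallyEq ?_).differentiableWithinAt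
      filter_upwards [isOpen_ne.mem_nhds h0] with z hz
      exact if_neg hz
  have hs' : 0 < s⁻¹ := inv_pos.2 hs0
  -- Analyticity of g beyond radius t > 1/s and uniqueness of Taylor series force the radius of `p`
  -- above 1/s.
  obtain ⟨t, hst, htq⟩ := exists_between (inv_strictAnti₀ hq0 hqs)
  have ht0 : 0 < t := hs'.trans hst
  have hball := (hgd.mono (closedBall_subset_ball htq)).hasFPowerSeriesOnBall
    (R := (⟨t, ht0.le⟩ : NNReal)) ht0
  have hpe := hball.hasFPowerSeriesAt.eq_formalMultilinearSeries hgp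
  rw [hpe] at hball
  have hrad : ENNReal.ofNNReal (⟨s⁻¹, hs'.le⟩ : NNReal) < p.radius :=
    lt_of_lt_of_le (ENNReal.coe_lt_coe.2 (show (⟨s⁻¹, hs'.le⟩ : NNReal) < ⟨t, ht0.le⟩ from hst)) hball.r_le
  obtain ⟨M, -, hM⟩ := p.norm_mul_pow_le_of_lt_radius hrad
  refine ⟨M, fun n => ?_⟩
  have h := hM n
  rw [hp, ContinuousMultilinearMap.norm_mkPiRing] at h
  change _ * (s⁻¹) ^ n ≤ M at h
  rwa [inv_pow, ← div_eq_mul_inv, div_le_iff₀ (by positivity)] at h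

/-- Termwise comparison of exponential series turns growth of powers into exponential type. -/
theorem norm_exp_smul_apply_le {T : X →L[ℂ] X} {x : X} {M s : ℝ}
    (h : ∀ n : ℕ, ‖(T ^ n) x‖ ≤ M * s ^ n) (z : ℂ) :
    ‖NormedSpace.exp (z • T) x‖ ≤ M * Real.exp (s * ‖z‖) := by
  have h1 := (ContinuousLinearMap.apply ℂ X x).hasSum
    (NormedSpace.exp_series_hasSum_exp' (𝕂 := ℂ) (z • T))
  have h2 : HasSum (fun n : ℕ => M * ((n.factorial : ℝ)⁻¹ • (s * ‖z‖) ^ n))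
      (M * Real.exp (s * ‖z‖)) := by
    rw [Real.exp_eq_exp_ℝ]
    exact (NormedSpace.exp_series_hasSum_exp' (𝕂 := ℝ) (s * ‖z‖)).mul_left M
  refine h1.norm_le_of_bounded h2 fun n => ?_
  simp only [ContinuousLinearMap.apply_apply, smul_apply, smul_pow, norm_smul,
    norm_inv, norm_pow, Complex.norm_natCast, smul_eq_mul]
  rw [mul_left_comm M, mul_pow, mul_comm (s ^ n), mul_left_comm M]
  gcongr
  exact h n

end LocalSpectrum

/-! ### Bernstein inequality -/

/-- The odd terms of ζ(2) sum to π²/6 - π²/24 = π²/8, and each odd square occurs twice over ℤ. This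
value makes the coefficient of s exactly 1. -/
theorem hasSum_int_one_div_odd_sq :
    HasSum (fun k : ℤ => 1 / |2 * (k : ℝ) + 1| ^ 2) (Real.pi ^ 2 / 4) := by
  have hex : ∃ a : ℕ → ℝ, a = fun n : ℕ => (1 : ℝ) / (n : ℝ) ^ 2 := ⟨_, rfl⟩
  obtain ⟨a, ha⟩ := hex
  have h1 : HasSum a (Real.pi ^ 2 / 6) := ha ▸ hasSum_zeta_two
  have heven : HasSum (fun n => a (2 * n)) (Real.pi ^ 2 / 6 / 4) := by
    have h : (fun n => a (2 * n)) = fun n => a n / 4 := by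
      funext n
      simp only [ha]
      push_cast
      rw [mul_pow, div_div]
      norm_num [mul_comm]
    rw [h]
    exact h1.div_const 4
  have hodd : Summable (fun n => a (2 * n + 1)) :=
    h1.summable.comp_injective (i := fun n : ℕ => 2 * n + 1) fun m n h => by simpa using h
  have hval : ∑' n, a (2 * n + 1) = Real.pi ^ 2 / 8 := by
    have h2 := (heven.even_add_odd hodd.hasSum).unique h1
    linarith
  have hodd' := hodd.hasSum
  rw [hval] at hodd'
  have hpos : (fun n : ℕ => 1 / |2 * ((n : ℤ) : ℝ) + 1| ^ 2) = fun n => a (2 * n + 1) := by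
    funext n
    simp only [ha]
    push_cast
    rw [sq_abs]
  have hneg : (fun n : ℕ => 1 / |2 * ((-((n : ℤ) + 1) : ℤ) : ℝ) + 1| ^ 2)
      = fun n => a (2 * n + 1) := by
    funext n
    simp only [ha]
    push_cast
    rw [sq_abs]
    ring
  have hz := HasSum.of_nat_of_neg_add_one (f := fun k : ℤ => 1 / |2 * (k : ℝ) + 1| ^ 2)
    (hpos ▸ hodd') (hneg ▸ hodd')
  convert hz using 1
  ring

/-- A Bernstein inequality for entire functions of exponential type with sublinear growth on the
real line. -/
theorem norm_deriv_zero_le_of_exp_type {F : ℂ → ℂ} (hF : Differentiable ℂ F) {M s C α : ℝ}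
    (hs : 0 < s) (hα0 : 0 ≤ α) (hα : α < 1) (hC : 0 ≤ C)
    (hexp : ∀ z, ‖F z‖ ≤ M * Real.exp (s * ‖z‖))
    (hreal : ∀ t : ℝ, ‖F t‖ ≤ C * (1 + |t| ^ α)) :
    ‖deriv F 0‖ ≤ C * (s + growthConst α * s ^ (1 - α)) := by
  have hπ := Real.pi_pos
  have hM : 0 ≤ M := by simpa using (norm_nonneg _).trans (hexp 0)
  set c : ℝ := Real.pi / s with hc
  have hc0 : 0 < c := by positivity
  -- The scaling c = π/s turns type s into type π. The odd part vanishes at 0, keeps the derivative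
  -- there, and obeys the same real bound; subtracting F(0) would worsen that bound.
  set f : ℂ → ℂ := fun z => (F (c * z) - F (-(c * z))) / 2 with hf
  have hfn : ∀ (z : ℂ) (B : ℝ), ‖F (c * z)‖ ≤ B → ‖F (-(c * z))‖ ≤ B → ‖f z‖ ≤ B := by
    intro z B h1 h2
    simp only [hf, norm_div, RCLike.norm_ofNat]
    have := norm_sub_le (F (c * z)) (F (-(c * z)))
    linarith
  have hfd : Differentiable ℂ f := by fun_prop
  have hf' : deriv f 0 = c * deriv F 0 := by
    have h0 : HasDerivAt F (deriv F 0) 0 := (hF 0).hasDerivAt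
    have h1 : HasDerivAt (fun z : ℂ => (c : ℂ) * z) (c * 1) 0 :=
      (hasDerivAt_id (0 : ℂ)).const_mul (c : ℂ)
    have h2 : HasDerivAt (fun z => F (c * z)) (deriv F 0 * (c * 1)) 0 :=
      HasDerivAt.comp 0 (by simpa using h0) h1
    have h3 : HasDerivAt (fun z => F (-(c * z))) (deriv F 0 * -(c * 1)) 0 :=
      HasDerivAt.comp 0 (by simpa using h0) h1.neg
    have h4 : HasDerivAt f ((deriv F 0 * (c * 1) - deriv F 0 * -(c * 1)) / 2) 0 :=
      (h2.sub h3).div_const 2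
    rw [h4.deriv]; ring
  have hPL := phragmenLindelof_exp_type hF hα0 hC hs.le hexp hreal
  have hbd : ∀ z, ‖f z‖ ≤ (max (2 * C) M * (1 + c) ^ α) * (1 + ‖z‖) ^ α
      * Real.exp (Real.pi * |z.im|) := by
    intro z
    have key : ∀ w : ℂ, ‖w‖ = c * ‖z‖ → |w.im| = c * |z.im| → ‖F w‖
        ≤ (max (2 * C) M * (1 + c) ^ α) * (1 + ‖z‖) ^ α * Real.exp (Real.pi * |z.im|) := by
      intro w hw1 hw2
      have h := hPL w
      rw [hw1, hw2, show s * (c * |z.im|) = Real.pi * |z.im| by rw [hc]; field_simp] at h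
      refine h.trans ?_
      rw [mul_assoc (max (2 * C) M) ((1 + c) ^ α), ← Real.mul_rpow (by positivity) (by positivity)]
      gcongr
      nlinarith [norm_nonneg z]
    refine hfn z _ (key _ ?_ ?_) (key _ ?_ ?_)
    · rw [norm_mul, Complex.norm_real, Real.norm_of_nonneg hc0.le]
    · rw [im_ofReal_mul, abs_mul, abs_of_pos hc0]
    · rw [norm_neg, norm_mul, Complex.norm_real, Real.norm_of_nonneg hc0.le]
    · rw [neg_im, abs_neg, im_ofReal_mul, abs_mul, abs_of_pos hc0]
  -- With m = |2k+1| the node is |t| = cm/2 and (k+1/2)² = m²/4, so the bound is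
  -- C(1+(cm/2)^α)·4/(πm²).
  set b : ℤ → ℝ := fun k => C * (4 / Real.pi) * (1 / |2 * (k : ℝ) + 1| ^ 2)
    + C * (4 / Real.pi) * (c / 2) ^ α * (1 / |2 * (k : ℝ) + 1| ^ (2 - α)) with hb
  have hsum : HasSum b (C * (4 / Real.pi) * (Real.pi ^ 2 / 4) + C * (4 / Real.pi) * (c / 2) ^ α
      * ∑' k : ℤ, 1 / |2 * (k : ℝ) + 1| ^ (2 - α)) :=
    (hasSum_int_one_div_odd_sq.mul_left _).add ((summable_growthConst hα).hasSum.mul_left _)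
  have hfb : ∀ k : ℤ, ‖f (k + 1 / 2)‖ / (Real.pi * (k + 1 / 2) ^ 2) ≤ b k := by
    intro k
    set m : ℝ := |2 * (k : ℝ) + 1| with hm
    have hm0 : 0 < m := abs_pos.2 fun h => by
      have h3 : (2 * k + 1 : ℤ) = 0 := by exact_mod_cast h
      omega
    have hk2 : ((k : ℝ) + 1 / 2) ^ 2 = m ^ 2 / 4 := by rw [hm, sq_abs]; ring
    have hz : (c : ℂ) * ((k : ℂ) + 1 / 2) = ((c * (k + 1 / 2) : ℝ) : ℂ) := by push_cast; ring
    have habs : |c * ((k : ℝ) + 1 / 2)| = c / 2 * m := by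
      rw [hm, abs_mul, abs_of_pos hc0, show (2 * (k : ℝ) + 1) = 2 * (k + 1 / 2) by ring, abs_mul,
        abs_two]
      ring
    have h1 : ‖f (k + 1 / 2)‖ ≤ C * (1 + (c / 2 * m) ^ α) := by
      refine hfn _ _ ?_ ?_
      · rw [hz, ← habs]; exact hreal _
      · rw [hz, ← habs, ← ofReal_neg, ← abs_neg]; exact hreal _
    rw [hk2]
    refine (div_le_div_of_nonneg_right h1 (by positivity)).trans (le_of_eq ?_)
    have h2 : m ^ (2 - α) = m ^ 2 / m ^ α := by
      rw [Real.rpow_sub hm0, Real.rpow_two]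
    simp only [hb, ← hm]
    rw [h2, Real.mul_rpow (by positivity) hm0.le]
    field_simp
  have hfin := norm_deriv_zero_le_tsum hfd (by simp [hf]) (by positivity) hα hbd hsum.summable hfb
  rw [hsum.tsum_eq, hf', norm_mul, Complex.norm_real, Real.norm_of_nonneg hc0.le,
    ← le_div_iff₀' hc0] at hfin
  refine hfin.trans (le_of_eq ?_)
  have h5 : (c / 2) ^ α = ((2 / Real.pi) ^ α)⁻¹ * (s ^ α)⁻¹ := by
    rw [← mul_inv, ← Real.mul_rpow (by positivity) hs.le, ← Real.inv_rpow (by positivity)]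
    congr 1
    rw [hc]; field_simp
  have h6 : (2 / Real.pi) ^ (2 - α) = (2 / Real.pi) ^ 2 / (2 / Real.pi) ^ α := by
    rw [Real.rpow_sub (by positivity), Real.rpow_two]
  have h7 : s ^ (1 - α) = s / s ^ α := by rw [Real.rpow_sub hs, Real.rpow_one]
  rw [growthConst, h5, h6, h7, hc]
  have : 0 < (2 / Real.pi) ^ α := by positivity
  have : 0 < s ^ α := by positivity
  field_simp
  ring

/-! ### Main theorem -/

theorem theorem4p2 {X : Type*} [NormedAddCommGroup X] [NormedSpace ℂ X] [CompleteSpace X]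
    (T : X →L[ℂ] X) (hT : HasSVEP T) (x : X) (α : ℝ) (hα0 : 0 ≤ α) (hα1 : α < 1)
    (C : ℝ) (hC : 0 < C)
    (hx : ∀ t : ℝ, ‖NormedSpace.exp ((t : ℂ) • T) x‖ ≤ C * (1 + |t| ^ α)) :
    ‖T x‖ ≤ C * (localSpectralRadius T x +
      growthConst α * localSpectralRadius T x ^ (1 - α)) := by
  have hr0 := localSpectralRadius_nonneg T x
  obtain ⟨φ, hφ, hφx⟩ := exists_dual_vector'' ℂ (T x)
  have hφle : ∀ y, ‖φ y‖ ≤ ‖y‖ := fun y =>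
    (φ.le_of_opNorm_le hφ y).trans (one_mul _).le
  have hd : ∀ z : ℂ, HasDerivAt (fun z : ℂ => φ (NormedSpace.exp (z • T) x))
      (φ ((NormedSpace.exp (z • T) * T) x)) z := fun z =>
    φ.hasFDerivAt.comp_hasDerivAt z
      ((ContinuousLinearMap.apply ℂ X x).hasFDerivAt.comp_hasDerivAt z
        (hasDerivAt_exp_smul_const T z))
  have hd0 : ‖deriv (fun z : ℂ => φ (NormedSpace.exp (z • T) x)) 0‖ = ‖T x‖ := by
    rw [(hd 0).deriv, zero_smul, NormedSpace.exp_zero, one_mul, hφx]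
    simp
  have hbound : ∀ s, localSpectralRadius T x < s →
      ‖T x‖ ≤ C * (s + growthConst α * s ^ (1 - α)) := by
    intro s hs
    obtain ⟨M, hM⟩ := hT.norm_pow_apply_le x hs
    rw [← hd0]
    exact norm_deriv_zero_le_of_exp_type (fun z => (hd z).differentiableAt) (hr0.trans_lt hs)
      hα0 hα1 hC.le (fun z => (hφle _).trans (norm_exp_smul_apply_le hM z))
      (fun t => (hφle _).trans (hx t))
  -- Since 1-α > 0, continuity holds at s = 0 too, covering a zero local spectral radius.
  have hcont : Continuous fun s : ℝ => C * (s + growthConst α * s ^ (1 - α)) :=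
    continuous_const.mul (continuous_id.add
      (continuous_const.mul (Real.continuous_rpow_const (by linarith))))
  exact ge_of_tendsto ((hcont.tendsto _).mono_left nhdsWithin_le_nhds)
    (eventually_nhdsWithin_of_forall hbound : ∀ᶠ s in 𝓝[>] localSpectralRadius T x, _)
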